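/- Notation. Let $\langle M\rangle=\{u,\widetilde u : u\in M\}$ for $M\subseteq\{0,1\}^*$, where $\widetilde u$ is $u$ with $0$ and $1$ exchanged; $M$ is $0$-$1$-symmetric if $M=\langle M\rangle$. A word is $k$-uniform over an alphabet if each letter of the alphabet occurs exactly $k$ times in it; $\{0,1\}^{k\text{-uni}}$ is the set of $k$-uniform binary words, and a binary language is $k$-uniform if all its words are. For a word $w\in\{0,1\}^{2d\text{-uni}}$ and $e\in\{1,2\}$, $1\le i\le d+1-e$, let $\delta_{i,i}^{2d\to 2e}(w)$ be obtained from $w$ by deleting all but the $(2i-1)$-st up to the $2(i-1+e)$-th occurrence of $0$ and all but the $(2i-1)$-st up to the $2(i-1+e)$-th occurrence of $1$. For a $0$-$1$-symmetric language $L$, a graph $G$ is in $\mathcal G_L$ if there is a word $w$, whose set of letters is exactly $V(G)$, such that for all distinct $u,v\in V(G)$: $\{u,v\}\in E(G)$ if and only if $h_{u,v}(w)\in L$, where $h_{u,v}$ maps $u\mapsto 0$, $v\mapsto 1$ and erases all other letters. Graphs are finite, simple and undirected, and isomorphic graphs are identified. Fix $d$ parallel lines. A $d$-trapezoid is given by one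 closed interval $[\ell_i,r_i]$ on each line $i=1,\dots,d$; it is the closed region bounded by the polygon $\ell_1\ell_2\cdots\ell_d\,r_d\cdots r_2r_1$ (an interval if $d=1$), and a $d$-trapezoid graph is an intersection graph of finitely many $d$-trapezoids on common lines. Trapezoid graphs, the intersection graphs of finitely many trapezoids between two common parallel lines, are the case $d=2$. A graph class $\mathcal C$ is factorial if there are constants $c_1,c_2>0$ with $n^{c_1n}\le|\mathcal C^n|\le n^{c_2n}$ for all $n\ge1$, where $\mathcal C^n$ is the set of graphs in $\mathcal C$ with vertex set $\{1,\dots,n\}$. Theorem. For every integer $d\ge1$, the language $$L^{\text{trap}}_d=\bigl\{w\in\{0,1\}^{2d\text{-uni}} : \exists\,1\le i\le d:\ \delta_{i,i}^{2d\to 2}(w)\in\langle 0101,0110\rangle\ \text{ or }\ \exists\,1\le i\le d-1:\ \delta_{i,i}^{2d\to 4}(w)\in\langle 00111100\rangle\bigr\}$$ is finite, $2d$-uniform and $0$-$1$-symmetric, and $\mathcal G_{L^{\text{trap}}_d}$ is exactly the class of $d$-trapezoid graphs. Consequently, for every $d\ge1$ the class of $d$-trapezoid graphs is factorial; in particular,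 the class of trapezoid graphs is factorial. -/

import Mathlib

universe u

/-! ### Words and languages over {0, 1} -/

/-- A word over `α` is `k`-uniform if every letter of `α` occurs exactly `k` times in it. -/
def IsUniformWord {α : Type*} [DecidableEq α] (k : ℕ) (w : List α) : Prop :=
  ∀ a : α, w.count a = k

/-- The complement morphism on binary words, exchanging `0` and `1`. -/
def complementWord (w : List (Fin 2)) : List (Fin 2) :=
  w.map fun a => 1 - a

/-- `⟨L⟩`: the words of `L` together with their complements. -/
def symmClosure (L : Language (Fin 2)) : Language (Fin 2) :=
  {w | ∃ u ∈ L, w = u ∨ w = complementWord u}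

/-- `L` is `0`-`1`-symmetric if `L = ⟨L⟩`. -/
def IsSymmLanguage (L : Language (Fin 2)) : Prop :=
  L = symmClosure L

/-- The subword of `w` on those positions `p` for which `P a j` holds, where `a` is the letter at
position `p` and this is the `j`-th occurrence of `a` in `w` (counting from 1). -/
def keepOccurrences (P : Fin 2 → ℕ → Bool) (w : List (Fin 2)) : List (Fin 2) :=
  ((List.finRange w.length).filter fun p =>
    P (w.get p) ((w.take ((p : ℕ) + 1)).count (w.get p))).map w.get

/-- The deletion operator `δ_{k,m}^{2ℓ → 2e}` for `k, m ≥ 1`: it deletes all but the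
`(2k-1)`-st up to the `2(k-1+e)`-th occurrence of `0` and all but the `(2m-1)`-st up to the
`2(m-1+e)`-th occurrence of `1`. The number `ℓ` only names the domain, the `2ℓ`-uniform words. -/
def deletion (k m e : ℕ) (w : List (Fin 2)) : List (Fin 2) :=
  keepOccurrences (fun a j =>
    if a = 0 then decide (2 * k - 1 ≤ j ∧ j ≤ 2 * (k - 1 + e))
    else decide (2 * m - 1 ≤ j ∧ j ≤ 2 * (m - 1 + e))) w

/-- The language `L^trap_d`: the `2d`-uniform binary words `w` such that the projection of `w` to
some pair of `i`-th intervals shows an overlap or a containment, or the projection of `w` to the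
`i`-th and `(i+1)`-st intervals, for some `1 ≤ i ≤ d - 1`, shows a crossing. -/
def trapLanguage (d : ℕ) : Language (Fin 2) :=
  {w | IsUniformWord (2 * d) w ∧
    ((∃ i : ℕ, 1 ≤ i ∧ i ≤ d ∧
        deletion i i 1 w ∈ symmClosure {[0, 1, 0, 1], [0, 1, 1, 0]}) ∨
      (∃ i : ℕ, 1 ≤ i ∧ i ≤ d - 1 ∧
        deletion i i 2 w ∈ symmClosure {[0, 0, 1, 1, 1, 1, 0, 0]}))}

/-! ### Graph classes and their speed -/

/-- A class of (simple, undirected) graphs. -/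
abbrev GraphClass : Type (u + 1) :=
  ∀ V : Type u, SimpleGraph V → Prop

/-- `n ↦ |C^n|`: the number of graphs of the class `C` with a fixed vertex set of size `n`. -/
noncomputable def speed (C : GraphClass.{0}) (n : ℕ) : ℕ :=
  Set.ncard {G : SimpleGraph (Fin n) | C (Fin n) G}

/-- `C` is factorial: `n^(c₁ n) ≤ |C^n| ≤ n^(c₂ n)` for all `n ≥ 1`, with constants
`c₁, c₂ > 0`. -/
def IsFactorialClass (C : GraphClass.{0}) : Prop :=
  ∃ c₁ c₂ : ℝ, 0 < c₁ ∧ 0 < c₂ ∧ ∀ n : ℕ, 1 ≤ n →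
    (n : ℝ) ^ (c₁ * (n : ℝ)) ≤ (speed C n : ℝ) ∧
      (speed C n : ℝ) ≤ (n : ℝ) ^ (c₂ * (n : ℝ))

/-! ### Graphs represented by words -/

open Classical in
/-- The morphism `h_{a,b}` (for `a ≠ b`): `a ↦ 0`, `b ↦ 1`, every other letter is erased. -/
noncomputable def pairProjection {V : Type*} (a b : V) (w : List V) : List (Fin 2) :=
  w.flatMap fun x => if x = a then [0] else if x = b then [1] else []

/-- `G` is `L`-represented by the word `w`, whose alphabet is exactly the vertex set of `G`. -/
def IsRepresentedBy (L : Language (Fin 2)) {V : Type*} (G : SimpleGraph V) (w : List V) : Prop :=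
  (∀ v : V, v ∈ w) ∧
    ∀ u v : V, u ≠ v → (G.Adj u v ↔ pairProjection u v w ∈ L)

/-- The graph class `𝒢_L` of all graphs that are `L`-represented by some word. Its members are
finite, since all vertices occur in a word. -/
def representedGraphs (L : Language (Fin 2)) : GraphClass.{u} :=
  fun V G => ∃ w : List V, IsRepresentedBy L G w

/-! ### Trapezoid graphs

A closed real interval is a `NonemptyInterval ℝ`, with left end `fst` and right end `snd`,
`fst ≤ snd`. -/

/-- The interval `I`, placed on the horizontal line of height `y` in the plane. -/
def intervalOnLine (I : NonemptyInterval ℝ) (y : ℝ) : Set (ℝ × ℝ) :=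
  segment ℝ (I.fst, y) (I.snd, y)

/-- The (filled) trapezoid spanned by the interval `I` on the line of height `y` and the interval
`J` on the line of height `z`. -/
def trapezoid (I J : NonemptyInterval ℝ) (y z : ℝ) : Set (ℝ × ℝ) :=
  convexHull ℝ {(I.fst, y), (I.snd, y), (J.fst, z), (J.snd, z)}

/-- The `d`-trapezoid given by one interval on each of `d` parallel lines (the lines of heights
`0, …, d - 1`): the closed region bounded by the polygon through the left ends
`ℓ₁, …, ℓ_d` and back through the right ends `r_d, …, r₁`. It consists of the trapezoids between
consecutive lines; the intervals are listed for the sake of `d = 1`. -/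
def dTrapezoid {d : ℕ} (I : Fin d → NonemptyInterval ℝ) : Set (ℝ × ℝ) :=
  (⋃ i : Fin d, intervalOnLine (I i) ((i : ℕ) : ℝ)) ∪
    ⋃ (i : Fin d) (j : Fin d) (_ : (j : ℕ) = (i : ℕ) + 1),
      trapezoid (I i) (I j) ((i : ℕ) : ℝ) ((j : ℕ) : ℝ)

/-- `G` is the intersection graph of the family of sets `T v`, `v` a vertex of `G`. -/
def IsIntersectionGraph {V X : Type*} (G : SimpleGraph V) (T : V → Set X) : Prop :=
  ∀ u v : V, G.Adj u v ↔ u ≠ v ∧ (T u ∩ T v).Nonempty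

/-- The class of `d`-trapezoid graphs: finite intersection graphs of `d`-trapezoids between `d`
common parallel lines. -/
def dTrapezoidGraphs (d : ℕ) : GraphClass.{u} :=
  fun V G => Finite V ∧ ∃ I : V → Fin d → NonemptyInterval ℝ,
    IsIntersectionGraph G fun v => dTrapezoid (I v)

/-- The class of trapezoid graphs: finite intersection graphs of trapezoids between two common
parallel lines. -/
def trapezoidGraphs : GraphClass.{u} :=
  fun V G => Finite V ∧ ∃ I J : V → NonemptyInterval ℝ,
    IsIntersectionGraph G fun v => trapezoid (I v) (J v) 0 1

/-! ### Occurrence deletion and prefixes -/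

/-! Counting lines from 0, occurrences number `2i+1` and `2i+2` of a letter encode the two ends of
its interval on line `i`. Both sides of the theorem reduce to one relation per line, "lies to the
left of": `PairPrecedes` for words and `LeftOnLine` for intervals. Membership in the language and
intersection of regions are then the same formula `OverlapOrCross` (`mem_trapLanguage_iff`,
`dTrapezoid_inter_nonempty_iff`). On the geometric side, ends interpolate linearly between
consecutive lines, so two regions are disjoint exactly when one is left of the other on every line.
On the word side, precedence is witnessed by a prefix, and prefixes commute with deletion and
projection.

It remains to transfer the left-of relations. Positions in a word serve as interval ends
(`exists_intervals_of_word`); conversely, listing all ends line by line in sorted order gives a word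
(`exists_word_of_intervals`).

For the speed, a graph is determined by a representing word of length `2dn`, which bounds the count
by `n ^ (2dn)`. Disjoint unions of cliques give the lower bound (`le_speed_dTrapezoidGraphs`). -/

lemma keepOccurrences_eq_range (P : Fin 2 → ℕ → Bool) (w : List (Fin 2)) :
    keepOccurrences P w = ((List.range w.length).filter fun p =>
      P (w.getD p 0) ((w.take (p + 1)).count (w.getD p 0))).map fun p => w.getD p 0 := by
  rw [← List.map_coe_finRange_eq_range, List.filter_map, List.map_map]
  unfold keepOccurrences
  have h : ∀ p : Fin w.length, w.getD p 0 = w.get p := fun p => by simp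
  simp only [Function.comp_def, h]

/-- The number of an occurrence depends only on the letters up to it, so appending a letter changes
no earlier decision. This drives all inductions from the right end. -/
lemma keepOccurrences_concat (P : Fin 2 → ℕ → Bool) (w : List (Fin 2)) (a : Fin 2) :
    keepOccurrences P (w ++ [a]) =
      keepOccurrences P w ++ if P a (w.count a + 1) then [a] else [] := by
  rw [keepOccurrences_eq_range, keepOccurrences_eq_range, List.length_append, List.length_singleton,
    List.range_succ, List.filter_append, List.map_append]
  have h : ∀ p ∈ List.range w.length, (w ++ [a]).getD p 0 = w.getD p 0 := by
    intro p hp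
    rw [List.mem_range] at hp
    simp [List.getD, List.getElem?_append_left hp]
  congr 1
  · rw [List.filter_congr (q := fun p => P (w.getD p 0) ((w.take (p + 1)).count (w.getD p 0)))]
    · exact List.map_congr_left fun p hp => h p (List.mem_of_mem_filter hp)
    · intro p hp
      rw [h p hp, List.take_append_of_le_length (List.mem_range.1 hp)]
  · have : (w ++ [a]).take (w.length + 1) = w ++ [a] := List.take_of_length_le (by simp)
    have h2 : (w ++ [a]).getD w.length 0 = a := by simp [List.getD]
    by_cases hP : P a (w.count a + 1) <;> simp [this, hP]

@[simp]
lemma deletion_nil (k m e : ℕ) : deletion k m e [] = [] := by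
  simp [deletion, keepOccurrences]

lemma deletion_concat (i e : ℕ) (w : List (Fin 2)) (a : Fin 2) :
    deletion (i + 1) (i + 1) e (w ++ [a]) = deletion (i + 1) (i + 1) e w ++
      if 2 * i ≤ w.count a ∧ w.count a < 2 * (i + e) then [a] else [] := by
  unfold deletion
  rw [keepOccurrences_concat]
  congr 2
  simp only [ite_self, decide_eq_true_eq, eq_iff_iff]
  omega

lemma count_deletion (i e : ℕ) (w : List (Fin 2)) (a : Fin 2) :
    (deletion (i + 1) (i + 1) e w).count a = min (w.count a) (2 * (i + e)) - 2 * i := by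
  induction w using List.reverseRecOn with
  | nil => simp
  | append_singleton w b ih =>
    rw [deletion_concat, List.count_append, List.count_append, ih]
    by_cases hab : b = a
    · subst hab
      split_ifs <;> simp <;> omega
    · split_ifs <;> simp [hab]

/-- Lets prefix conditions on a short deleted word, which can be checked by enumeration, be read as
conditions on prefixes of `w`. -/
lemma prefix_deletion_iff (i e : ℕ) (w q : List (Fin 2)) :
    q <+: deletion (i + 1) (i + 1) e w ↔ ∃ p, p <+: w ∧ q = deletion (i + 1) (i + 1) e p := by
  induction w using List.reverseRecOn with
  | nil => simp
  | append_singleton w b ih =>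
    simp only [List.prefix_concat_iff, or_and_right, exists_or, exists_eq_left, ← ih]
    rw [deletion_concat]
    split_ifs
    · rw [List.prefix_concat_iff]
    · simp only [List.append_nil]
      exact ⟨Or.inr, fun h => h.elim (fun h => h ▸ List.prefix_rfl) id⟩

@[simp]
lemma complementWord_complementWord (w : List (Fin 2)) :
    complementWord (complementWord w) = w := by
  unfold complementWord
  rw [List.map_map]
  exact (List.map_congr_left fun a _ => by fin_cases a <;> rfl).trans w.map_id

lemma count_complementWord (w : List (Fin 2)) (a : Fin 2) :
    (complementWord w).count a = w.count (1 - a) := by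
  have h : a = 1 - (1 - a) := by fin_cases a <;> rfl
  conv_lhs => rw [h]
  exact List.count_map_of_injective w (fun a : Fin 2 => 1 - a) (by decide) _

lemma deletion_complementWord (i e : ℕ) (w : List (Fin 2)) :
    deletion (i + 1) (i + 1) e (complementWord w) =
      complementWord (deletion (i + 1) (i + 1) e w) := by
  induction w using List.reverseRecOn with
  | nil => simp [complementWord]
  | append_singleton w b ih =>
    have h : ∀ u v, complementWord (u ++ v) = complementWord u ++ complementWord v :=
      fun u v => List.map_append
    have hb : complementWord [b] = [1 - b] := rfl
    have hbb : 1 - (1 - b) = b := by fin_cases b <;> rfl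
    rw [h, hb, deletion_concat, deletion_concat, h, ih, count_complementWord, hbb]
    split_ifs <;> rfl

lemma mem_symmClosure_complementWord_iff (L : Language (Fin 2)) (w : List (Fin 2)) :
    complementWord w ∈ symmClosure L ↔ w ∈ symmClosure L := by
  have key : ∀ w, w ∈ symmClosure L → complementWord w ∈ symmClosure L := by
    rintro w ⟨u, hu, rfl | rfl⟩
    · exact ⟨w, hu, Or.inr rfl⟩
    · exact ⟨u, hu, Or.inl (complementWord_complementWord u)⟩
  exact ⟨fun h => complementWord_complementWord w ▸ key _ h, key w⟩

/-! ### The language of `d`-trapezoids -/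

/-- The `i`-th pair of occurrences of `u` in `w` (counting from 0) lies entirely to the left of
the `i`-th pair of occurrences of `v`. -/
def PairPrecedes {α : Type*} [DecidableEq α] (w : List α) (i : ℕ) (u v : α) : Prop :=
  ∃ p, p <+: w ∧ 2 * i + 2 ≤ p.count u ∧ p.count v ≤ 2 * i

/-- For relations `R i`, `i < d`, expressing that one interval on the `i`-th line lies to the left
of another one: the intervals overlap on some line, or cross between two consecutive lines. -/
def OverlapOrCross {α : Type*} (d : ℕ) (R : ℕ → α → α → Prop) (u v : α) : Prop :=
  (∃ i < d, ¬ R i u v ∧ ¬ R i v u) ∨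
    ∃ i, i + 1 < d ∧ (R i u v ∧ R (i + 1) v u ∨ R i v u ∧ R (i + 1) u v)

lemma OverlapOrCross.congr {α β : Type*} {d : ℕ} {R : ℕ → α → α → Prop} {S : ℕ → β → β → Prop}
    {u v : α} {x y : β} (h : ∀ i < d, (R i u v ↔ S i x y) ∧ (R i v u ↔ S i y x)) :
    OverlapOrCross d R u v ↔ OverlapOrCross d S x y := by
  unfold OverlapOrCross
  refine or_congr (exists_congr fun i => and_congr_right fun hi => ?_)
    (exists_congr fun i => and_congr_right fun hi => ?_)
  · rw [(h i hi).1, (h i hi).2]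
  · rw [(h i (by omega)).1, (h i (by omega)).2, (h _ hi).1, (h _ hi).2]

lemma length_eq_count_add_count (w : List (Fin 2)) : w.length = w.count 0 + w.count 1 := by
  induction w with
  | nil => rfl
  | cons a w ih =>
    rw [List.length_cons, ih, List.count_cons, List.count_cons]
    fin_cases a <;> simp <;> omega

set_option synthInstance.maxSize 1000 in
-- Of the six words with two letters of each kind, only 0011 and 1100 separate the pairs.
-- Quantifying over `inits` makes the claim decidable.
lemma overlap_iff_forall_prefix (D : List (Fin 2)) (h0 : D.count 0 = 2) (h1 : D.count 1 = 2) :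
    D ∈ symmClosure {[0, 1, 0, 1], [0, 1, 1, 0]} ↔
      (¬ ∃ q ∈ D.inits, 2 ≤ q.count 0 ∧ q.count 1 ≤ 0) ∧
        ¬ ∃ q ∈ D.inits, 2 ≤ q.count 1 ∧ q.count 0 ≤ 0 := by
  have hmem : D ∈ symmClosure {[0, 1, 0, 1], [0, 1, 1, 0]} ↔
      D = [0, 1, 0, 1] ∨ D = [1, 0, 1, 0] ∨ D = [0, 1, 1, 0] ∨ D = [1, 0, 0, 1] := by
    constructor
    · rintro ⟨u, rfl | rfl, rfl | rfl⟩ <;> decide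
    · rintro (rfl | rfl | rfl | rfl)
      · exact ⟨[0, 1, 0, 1], Or.inl rfl, Or.inl rfl⟩
      · exact ⟨[0, 1, 0, 1], Or.inl rfl, Or.inr rfl⟩
      · exact ⟨[0, 1, 1, 0], Or.inr rfl, Or.inl rfl⟩
      · exact ⟨[0, 1, 1, 0], Or.inr rfl, Or.inr rfl⟩
  rw [hmem]
  clear hmem
  have hl : D.length = 4 := by rw [length_eq_count_add_count, h0, h1]
  match D, hl with
  | [a, b, c, d], _ =>
    revert a b c d
    decide

/-- If 0 is left on the first line and 1 on the second, then two 0s precede every 1 and all four 1s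
precede the third 0, which forces 00111100. The thresholds 2, 0 and 4, 2 belong to the first and
second pair. -/
lemma cross_iff_exists_prefix (D : List (Fin 2)) (h0 : D.count 0 = 4) (h1 : D.count 1 = 4) :
    D ∈ symmClosure {[0, 0, 1, 1, 1, 1, 0, 0]} ↔
      ((∃ q ∈ D.inits, 2 ≤ q.count 0 ∧ q.count 1 ≤ 0) ∧
        ∃ q ∈ D.inits, 4 ≤ q.count 1 ∧ q.count 0 ≤ 2) ∨
      ((∃ q ∈ D.inits, 2 ≤ q.count 1 ∧ q.count 0 ≤ 0) ∧
        ∃ q ∈ D.inits, 4 ≤ q.count 0 ∧ q.count 1 ≤ 2) := by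
  have hmem : D ∈ symmClosure {[0, 0, 1, 1, 1, 1, 0, 0]} ↔
      D = [0, 0, 1, 1, 1, 1, 0, 0] ∨ D = [1, 1, 0, 0, 0, 0, 1, 1] := by
    constructor
    · rintro ⟨u, rfl, rfl | rfl⟩ <;> decide
    · rintro (rfl | rfl)
      · exact ⟨_, rfl, Or.inl rfl⟩
      · exact ⟨_, rfl, Or.inr rfl⟩
  rw [hmem]
  clear hmem
  have hl : D.length = 8 := by rw [length_eq_count_add_count, h0, h1]
  match D, hl with
  | [a, b, c, d, e, f, g, h], _ =>
    revert a b c d e f g h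
    decide +kernel

lemma mem_trapLanguage_iff (d : ℕ) (w : List (Fin 2)) :
    w ∈ trapLanguage d ↔ IsUniformWord (2 * d) w ∧ OverlapOrCross d (PairPrecedes w) 0 1 := by
  refine and_congr_right fun hw => ?_
  -- The primed thresholds are relative to the window of kept occurrences. Since `0 < x' ≤ 2e` and
  -- `y' < 2e`, truncating the counts at both ends of the window does not affect the comparisons.
  have hpre : ∀ (i e x y x' y' : ℕ) (a b : Fin 2), x' ≤ 2 * e → y' < 2 * e →
      x = 2 * i + x' → y = 2 * i + y' → 0 < x' →
      ((∃ q ∈ (deletion (i + 1) (i + 1) e w).inits, x' ≤ q.count a ∧ q.count b ≤ y') ↔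
        ∃ p, p <+: w ∧ x ≤ p.count a ∧ p.count b ≤ y) := by
    intro i e x y x' y' a b hx hy hx' hy' h0
    simp only [List.mem_inits, prefix_deletion_iff]
    constructor
    · rintro ⟨_, ⟨p, hp, rfl⟩, h1, h2⟩
      rw [count_deletion] at h1 h2
      exact ⟨p, hp, by omega, by omega⟩
    · rintro ⟨p, hp, h1, h2⟩
      refine ⟨_, ⟨p, hp, rfl⟩, ?_⟩
      rw [count_deletion, count_deletion]
      omega
  refine or_congr ?_ ?_
  · constructor
    · rintro ⟨i, hi, hid, h⟩
      obtain ⟨i, rfl⟩ := Nat.exists_eq_add_of_le' hi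
      have hc : ∀ a, (deletion (i + 1) (i + 1) 1 w).count a = 2 := fun a => by
        rw [count_deletion, hw a]; omega
      rw [overlap_iff_forall_prefix _ (hc 0) (hc 1),
        hpre i 1 (2 * i + 2) (2 * i) 2 0 0 1, hpre i 1 (2 * i + 2) (2 * i) 2 0 1 0] at h <;>
        first | exact ⟨i, hid, h⟩ | omega
    · rintro ⟨i, hid, h⟩
      refine ⟨i + 1, by omega, hid, ?_⟩
      have hc : ∀ a, (deletion (i + 1) (i + 1) 1 w).count a = 2 := fun a => by
        rw [count_deletion, hw a]; omega
      rw [overlap_iff_forall_prefix _ (hc 0) (hc 1),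
        hpre i 1 (2 * i + 2) (2 * i) 2 0 0 1, hpre i 1 (2 * i + 2) (2 * i) 2 0 1 0] <;>
        first | exact h | omega
  · have key : ∀ i, i + 1 < d → (deletion (i + 1) (i + 1) 2 w ∈
        symmClosure {[0, 0, 1, 1, 1, 1, 0, 0]} ↔
        (PairPrecedes w i 0 1 ∧ PairPrecedes w (i + 1) 1 0 ∨
          PairPrecedes w i 1 0 ∧ PairPrecedes w (i + 1) 0 1)) := by
      intro i hi
      have hc : ∀ a, (deletion (i + 1) (i + 1) 2 w).count a = 4 := fun a => by
        rw [count_deletion, hw a]; omega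
      rw [cross_iff_exists_prefix _ (hc 0) (hc 1),
        hpre i 2 (2 * i + 2) (2 * i) 2 0 0 1, hpre i 2 (2 * i + 2) (2 * i) 2 0 1 0,
        hpre i 2 (2 * (i + 1) + 2) (2 * (i + 1)) 4 2 0 1,
        hpre i 2 (2 * (i + 1) + 2) (2 * (i + 1)) 4 2 1 0] <;>
        first | exact Iff.rfl | omega
    constructor
    · rintro ⟨i, hi, hid, h⟩
      obtain ⟨i, rfl⟩ := Nat.exists_eq_add_of_le' hi
      exact ⟨i, by omega, (key i (by omega)).1 h⟩
    · rintro ⟨i, hid, h⟩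
      exact ⟨i + 1, by omega, by omega, (key i hid).2 h⟩

lemma finite_trapLanguage (d : ℕ) : (trapLanguage d : Set (List (Fin 2))).Finite := by
  refine (List.finite_length_eq (Fin 2) (2 * d + 2 * d)).subset fun w hw => ?_
  change w.length = _
  rw [length_eq_count_add_count, hw.1 0, hw.1 1]

lemma isSymmLanguage_trapLanguage (d : ℕ) : IsSymmLanguage (trapLanguage d) := by
  ext w
  constructor
  · exact fun h => ⟨w, h, Or.inl rfl⟩
  · rintro ⟨u, hu, rfl | rfl⟩
    · exact hu
    · refine ⟨fun a => by rw [count_complementWord, hu.1], ?_⟩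
      refine hu.2.imp ?_ ?_ <;>
      · rintro ⟨i, hi, hid, h⟩
        refine ⟨i, hi, hid, ?_⟩
        obtain ⟨i, rfl⟩ := Nat.exists_eq_add_of_le' hi
        rwa [deletion_complementWord, mem_symmClosure_complementWord_iff]

/-! ### Projections to two letters -/

section Projection

variable {V : Type*} [DecidableEq V]

lemma pairProjection_concat (a b x : V) (w : List V) :
    pairProjection a b (w ++ [x]) =
      pairProjection a b w ++ if x = a then [0] else if x = b then [1] else [] := by
  simp only [pairProjection, List.flatMap_append, List.flatMap_singleton]
  split_ifs <;> rfl

lemma count_zero_pairProjection (a b : V) (w : List V) :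
    (pairProjection a b w).count 0 = w.count a := by
  induction w using List.reverseRecOn with
  | nil => rfl
  | append_singleton w x ih =>
    rw [pairProjection_concat, List.count_append, List.count_append, ih]
    split_ifs with h1 h2 <;> simp [h1]

lemma count_one_pairProjection {a b : V} (hab : a ≠ b) (w : List V) :
    (pairProjection a b w).count 1 = w.count b := by
  induction w using List.reverseRecOn with
  | nil => rfl
  | append_singleton w x ih =>
    rw [pairProjection_concat, List.count_append, List.count_append, ih]
    split_ifs with h1 h2
    · simp [h1, hab]
    · simp [h2]
    · simp [h2]

lemma prefix_pairProjection_iff (a b : V) (w : List V) (q : List (Fin 2)) :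
    q <+: pairProjection a b w ↔ ∃ p, p <+: w ∧ q = pairProjection a b p := by
  induction w using List.reverseRecOn with
  | nil => simp [pairProjection]
  | append_singleton w x ih =>
    simp only [List.prefix_concat_iff, or_and_right, exists_or, exists_eq_left, ← ih]
    rw [pairProjection_concat]
    split_ifs
    · rw [List.prefix_concat_iff]
    · rw [List.prefix_concat_iff]
    · simp only [List.append_nil]
      exact ⟨Or.inr, fun h => h.elim (fun h => h ▸ List.prefix_rfl) id⟩

/-- The count condition involves each letter separately, so a letter with the wrong number of
occurrences is an isolated vertex. -/
lemma pairProjection_mem_trapLanguage_iff {a b : V} (hab : a ≠ b) (d : ℕ) (w : List V) :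
    pairProjection a b w ∈ trapLanguage d ↔
      (w.count a = 2 * d ∧ w.count b = 2 * d) ∧ OverlapOrCross d (PairPrecedes w) a b := by
  rw [mem_trapLanguage_iff]
  refine and_congr ?_ (OverlapOrCross.congr fun i _ => ⟨?_, ?_⟩)
  · unfold IsUniformWord
    rw [Fin.forall_fin_two, count_zero_pairProjection, count_one_pairProjection hab]
  all_goals
    simp only [PairPrecedes, prefix_pairProjection_iff]
    constructor
    · rintro ⟨_, ⟨p, hp, rfl⟩, h⟩
      rw [count_zero_pairProjection, count_one_pairProjection hab] at h
      exact ⟨p, hp, h⟩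
    · rintro ⟨p, hp, h⟩
      refine ⟨_, ⟨p, hp, rfl⟩, ?_⟩
      rwa [count_zero_pairProjection, count_one_pairProjection hab]

end Projection

/-! ### Intersections of `d`-trapezoids -/

lemma mem_intervalOnLine_iff (I : NonemptyInterval ℝ) (y : ℝ) (p : ℝ × ℝ) :
    p ∈ intervalOnLine I y ↔ p.2 = y ∧ I.fst ≤ p.1 ∧ p.1 ≤ I.snd := by
  obtain ⟨a, b⟩ := p
  rw [intervalOnLine, ← Prod.image_mk_segment_left, segment_eq_Icc I.fst_le_snd]
  simp only [Set.mem_image, Set.mem_Icc, Prod.mk.injEq]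
  constructor
  · rintro ⟨x, hx, rfl, rfl⟩
    exact ⟨rfl, hx⟩
  · rintro ⟨rfl, hx⟩
    exact ⟨a, hx, rfl, rfl⟩

/-- The right-hand side describes a convex set containing the four corners. Lines at distance 1 make
the relative height `t` the interpolation parameter. -/
lemma trapezoid_subset (I J : NonemptyInterval ℝ) (y z : ℝ) (hyz : z = y + 1) {p : ℝ × ℝ}
    (hp : p ∈ trapezoid I J y z) :
    ∃ t : ℝ, 0 ≤ t ∧ t ≤ 1 ∧ p.2 = y + t ∧ (1 - t) * I.fst + t * J.fst ≤ p.1 ∧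
      p.1 ≤ (1 - t) * I.snd + t * J.snd := by
  have hI := I.fst_le_snd
  have hJ := J.fst_le_snd
  have hconv : Convex ℝ {p : ℝ × ℝ | ∃ t : ℝ, 0 ≤ t ∧ t ≤ 1 ∧ p.2 = y + t ∧
      (1 - t) * I.fst + t * J.fst ≤ p.1 ∧ p.1 ≤ (1 - t) * I.snd + t * J.snd} := by
    rintro p ⟨s, hs0, hs1, hs, hsl, hsr⟩ q ⟨t, ht0, ht1, ht, htl, htr⟩ a b ha hb hab
    have ha' : a = 1 - b := by linarith
    refine ⟨a * s + b * t, by positivity, by nlinarith, ?_, ?_, ?_⟩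
    · simp only [Prod.snd_add, Prod.smul_snd, smul_eq_mul, hs, ht]
      subst ha'; ring
    · simp only [Prod.fst_add, Prod.smul_fst, smul_eq_mul]
      have h1 := mul_le_mul_of_nonneg_left hsl ha
      have h2 := mul_le_mul_of_nonneg_left htl hb
      subst ha'
      linarith
    · simp only [Prod.fst_add, Prod.smul_fst, smul_eq_mul]
      have h1 := mul_le_mul_of_nonneg_left hsr ha
      have h2 := mul_le_mul_of_nonneg_left htr hb
      subst ha'
      linarith
  refine convexHull_min ?_ hconv hp
  rintro q (rfl | rfl | rfl | rfl)
  · exact ⟨0, le_rfl, zero_le_one, by simp, by simp, by simpa using hI⟩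
  · exact ⟨0, le_rfl, zero_le_one, by simp, by simpa using hI, by simp⟩
  · exact ⟨1, zero_le_one, le_rfl, hyz, by simp, by simpa using hJ⟩
  · exact ⟨1, zero_le_one, le_rfl, hyz, by simpa using hJ, by simp⟩

/-- Points with `t = 1` are moved to the next line with `t = 0`. Thus `i` and `t` are determined by
the height, and two regions can be compared at a common point; `j` is a dummy when `t = 0`. -/
lemma exists_of_mem_dTrapezoid {d : ℕ} {I : Fin d → NonemptyInterval ℝ} {p : ℝ × ℝ}
    (hp : p ∈ dTrapezoid I) :
    ∃ (i j : Fin d) (t : ℝ), 0 ≤ t ∧ t < 1 ∧ p.2 = (i : ℕ) + t ∧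
      (t = 0 ∨ (j : ℕ) = i + 1) ∧ (1 - t) * (I i).fst + t * (I j).fst ≤ p.1 ∧
      p.1 ≤ (1 - t) * (I i).snd + t * (I j).snd := by
  rcases hp with hp | hp
  · obtain ⟨i, hp⟩ := Set.mem_iUnion.1 hp
    obtain ⟨h, hl, hr⟩ := (mem_intervalOnLine_iff _ _ _).1 hp
    exact ⟨i, i, 0, le_rfl, one_pos, by simpa using h, Or.inl rfl, by simpa using hl,
      by simpa using hr⟩
  · simp only [Set.mem_iUnion] at hp
    obtain ⟨i, j, hij, hp⟩ := hp
    obtain ⟨t, ht0, ht1, h, hl, hr⟩ := trapezoid_subset _ _ _ _ (by rw [hij]; push_cast; rfl) hp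
    rcases ht1.lt_or_eq with ht1 | rfl
    · exact ⟨i, j, t, ht0, ht1, h, Or.inr hij, hl, hr⟩
    · refine ⟨j, j, 0, le_rfl, one_pos, ?_, Or.inl rfl, by simpa using hl, by simpa using hr⟩
      rw [h, hij]
      push_cast
      ring

lemma intervalOnLine_subset_dTrapezoid {d : ℕ} (I : Fin d → NonemptyInterval ℝ) (i : Fin d) :
    intervalOnLine (I i) (i : ℕ) ⊆ dTrapezoid I :=
  fun _ hp => Or.inl (Set.mem_iUnion.2 ⟨i, hp⟩)

lemma trapezoid_subset_dTrapezoid {d : ℕ} (I : Fin d → NonemptyInterval ℝ) {i j : Fin d}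
    (hij : (j : ℕ) = i + 1) : trapezoid (I i) (I j) (i : ℕ) (j : ℕ) ⊆ dTrapezoid I := by
  intro p hp
  refine Or.inr ?_
  simp only [Set.mem_iUnion]
  exact ⟨i, j, hij, hp⟩

/-- The gap from the right side of `I` to the left side of `J` runs linearly from `a > 0` on line
`i` to `-b < 0` on line `j`. It vanishes at weight `a / (a + b)`, where the two sides meet. -/
lemma dTrapezoid_inter_nonempty_of_cross {d : ℕ} {I J : Fin d → NonemptyInterval ℝ} {i j : Fin d}
    (hij : (j : ℕ) = i + 1) (hi : (I i).snd < (J i).fst) (hj : (J j).snd < (I j).fst) :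
    (dTrapezoid I ∩ dTrapezoid J).Nonempty := by
  have hI := (I j).fst_le_snd
  have hJ := (J j).fst_le_snd
  set a := (J i).fst - (I i).snd with ha
  set b := (I j).snd - (J j).fst with hb
  have ha0 : 0 < a := sub_pos.2 hi
  have hb0 : 0 < b := by rw [hb]; linarith
  have hab : b / (a + b) + a / (a + b) = 1 := by field_simp; ring
  have h1 : (0 : ℝ) ≤ b / (a + b) := by positivity
  have h2 : (0 : ℝ) ≤ a / (a + b) := by positivity
  refine ⟨(b / (a + b)) • ((I i).snd, ((i : ℕ) : ℝ)) + (a / (a + b)) • ((I j).snd, ((j : ℕ) : ℝ)),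
    trapezoid_subset_dTrapezoid I hij ?_, trapezoid_subset_dTrapezoid J hij ?_⟩
  · exact segment_subset_convexHull (by simp) (by simp) ⟨_, _, h1, h2, hab, rfl⟩
  · refine segment_subset_convexHull (x := ((J i).fst, ((i : ℕ) : ℝ)))
      (y := ((J j).fst, ((j : ℕ) : ℝ))) (by simp) (by simp) ⟨_, _, h1, h2, hab, ?_⟩
    refine Prod.ext ?_ rfl
    simp only [Prod.fst_add, Prod.smul_fst, smul_eq_mul]
    have e1 : (J i).fst = (I i).snd + a := by rw [ha]; ring
    have e2 : (I j).snd = (J j).fst + b := by rw [hb]; ring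
    rw [e1, e2]
    field_simp
    ring

/-- The interval of `u` on the line number `i` lies to the left of that of `v`. -/
def LeftOnLine {V : Type*} {d : ℕ} (I : V → Fin d → NonemptyInterval ℝ) (i : ℕ) (u v : V) : Prop :=
  ∃ h : i < d, (I u ⟨i, h⟩).snd < (I v ⟨i, h⟩).fst

section Intersection

variable {V : Type*} {d : ℕ} {I : V → Fin d → NonemptyInterval ℝ} {u v : V}

lemma leftOnLine_coe_iff (i : Fin d) : LeftOnLine I i u v ↔ (I u i).snd < (I v i).fst :=
  ⟨fun h => h.2, fun h => ⟨i.2, h⟩⟩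

lemma LeftOnLine.asymm {i : ℕ} (h : LeftOnLine I i u v) : ¬ LeftOnLine I i v u := by
  rintro ⟨hi, h'⟩
  have h := h.2
  have h1 := (I u ⟨i, hi⟩).fst_le_snd
  have h2 := (I v ⟨i, hi⟩).fst_le_snd
  linarith

lemma overlapOrCross_comm {α : Type*} {d : ℕ} {R : ℕ → α → α → Prop} {u v : α} :
    OverlapOrCross d R u v ↔ OverlapOrCross d R v u := by
  unfold OverlapOrCross
  refine or_congr (exists_congr fun i => and_congr_right fun _ => and_comm)
    (exists_congr fun i => and_congr_right fun _ => or_comm)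

lemma not_overlapOrCross_of_forall_left (h : ∀ i < d, LeftOnLine I i u v) :
    ¬ OverlapOrCross d (LeftOnLine I) u v := by
  rintro (⟨i, hi, h', -⟩ | ⟨i, hi, ⟨-, h'⟩ | ⟨h', -⟩⟩)
  · exact h' (h i hi)
  · exact (h _ hi).asymm h'
  · exact (h i (by omega)).asymm h'

/-- Without overlap or crossing, the two lines around a common point show the same strict order, and
interpolation keeps it strict at that height, a contradiction. Conversely, overlapping intervals
share the larger of their left ends. -/
lemma dTrapezoid_inter_nonempty_iff :
    (dTrapezoid (I u) ∩ dTrapezoid (I v)).Nonempty ↔ OverlapOrCross d (LeftOnLine I) u v := by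
  constructor
  · rintro ⟨p, hu, hv⟩
    by_contra hne
    simp only [OverlapOrCross, not_or, not_exists, not_and, not_not] at hne
    obtain ⟨hover, hcross⟩ := hne
    obtain ⟨i, j, t, ht0, ht1, hp, hj, hul, hur⟩ := exists_of_mem_dTrapezoid hu
    obtain ⟨i', j', t', ht0', ht1', hp', hj', hvl, hvr⟩ := exists_of_mem_dTrapezoid hv
    have hii : i' = i := by
      have h1 : ((i' : ℕ) : ℝ) < (i : ℕ) + 1 := by linarith
      have h2 : ((i : ℕ) : ℝ) < (i' : ℕ) + 1 := by linarith
      norm_cast at h1 h2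
      omega
    subst hii
    obtain rfl : t' = t := by linarith
    rcases ht0.eq_or_lt with rfl | ht
    · simp only [sub_zero, one_mul, zero_mul, add_zero] at hul hur hvl hvr
      have o1 := hover i' i'.2
      simp only [leftOnLine_coe_iff] at o1
      by_cases h : (I u i').snd < (I v i').fst
      · linarith
      · have h1 := o1 h
        linarith
    · have hj1 : (j : ℕ) = i' + 1 := hj.resolve_left ht.ne'
      obtain rfl : j' = j := Fin.ext ((hj'.resolve_left ht.ne').trans hj1.symm)
      have hc := hcross i' (hj1 ▸ j'.2)
      rw [← hj1] at hc
      have o1 := hover i' i'.2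
      have o2 := hover j' j'.2
      simp only [leftOnLine_coe_iff] at hc o1 o2
      have ht1'' : 0 < 1 - t' := by linarith
      by_cases h : (I u i').snd < (I v i').fst
      · have h2 : (I u j').snd < (I v j').fst := by tauto
        have e1 := mul_lt_mul_of_pos_left h ht1''
        have e2 := mul_lt_mul_of_pos_left h2 ht
        linarith
      · have h1 : (I v i').snd < (I u i').fst := by tauto
        have h2 : (I v j').snd < (I u j').fst := by tauto
        have e1 := mul_lt_mul_of_pos_left h1 ht1''
        have e2 := mul_lt_mul_of_pos_left h2 ht
        linarith
  · rintro (⟨i, hi, h1, h2⟩ | ⟨i, hi, ⟨h1, h2⟩ | ⟨h1, h2⟩⟩)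
    · lift i to Fin d using hi
      rw [leftOnLine_coe_iff, not_lt] at h1 h2
      refine ⟨(max (I u i).fst (I v i).fst, (i : ℕ)),
        intervalOnLine_subset_dTrapezoid _ i ((mem_intervalOnLine_iff _ _ _).2 ⟨rfl, ?_⟩),
        intervalOnLine_subset_dTrapezoid _ i ((mem_intervalOnLine_iff _ _ _).2 ⟨rfl, ?_⟩)⟩
      · exact ⟨le_max_left _ _, max_le (I u i).fst_le_snd h1⟩
      · exact ⟨le_max_right _ _, max_le h2 (I v i).fst_le_snd⟩
    · exact dTrapezoid_inter_nonempty_of_cross rfl h1.2 h2.2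
    · rw [Set.inter_comm]
      exact dTrapezoid_inter_nonempty_of_cross rfl h1.2 h2.2

end Intersection

/-- For `d = 2` the two intervals are sides of the single trapezoid and add nothing to the union. -/
lemma trapezoidGraphs_eq : trapezoidGraphs.{u} = dTrapezoidGraphs 2 := by
  have key : ∀ K : Fin 2 → NonemptyInterval ℝ, dTrapezoid K = trapezoid (K 0) (K 1) 0 1 := by
    intro K
    refine Set.Subset.antisymm (Set.union_subset ?_ ?_) ?_
    · refine Set.iUnion_subset fun i => (convex_convexHull ℝ _).segment_subset ?_ ?_ <;>
        refine subset_convexHull ℝ _ ?_ <;> fin_cases i <;> simp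
    · refine Set.iUnion_subset fun i => Set.iUnion_subset fun j => Set.iUnion_subset fun h => ?_
      obtain rfl : i = 0 := by omega
      obtain rfl : j = 1 := by omega
      simp
    · simpa using trapezoid_subset_dTrapezoid K (i := 0) (j := 1) rfl
  funext V G
  refine propext (and_congr_right fun _ => ?_)
  constructor
  · rintro ⟨I, J, h⟩
    refine ⟨fun v => ![I v, J v], ?_⟩
    simp only [key]
    exact h
  · rintro ⟨K, h⟩
    refine ⟨fun v => K v 0, fun v => K v 1, ?_⟩
    simpa only [key] using h

/-! ### Intervals from words -/

section Position

variable {V : Type*} [DecidableEq V]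

/-- The length of the shortest prefix of `w` in which `u` occurs at least `k` times. -/
noncomputable def occurrencePosition (w : List V) (u : V) (k : ℕ) : ℕ :=
  sInf {n | k ≤ (w.take n).count u}

/-- A Galois connection between positions and prefix counts. It needs `hk`, because the infimum of
the empty set is 0. -/
lemma occurrencePosition_le_iff {w : List V} {u : V} {k : ℕ} (hk : k ≤ w.count u) (n : ℕ) :
    occurrencePosition w u k ≤ n ↔ k ≤ (w.take n).count u := by
  constructor
  · intro h
    have hmem : occurrencePosition w u k ∈ {n | k ≤ (w.take n).count u} :=
      Nat.sInf_mem ⟨w.length, by simpa using hk⟩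
    exact hmem.trans ((List.take_prefix_take_left h).sublist.count_le u)
  · exact fun h => Nat.sInf_le h

lemma occurrencePosition_le_length {w : List V} {u : V} {k : ℕ} (hk : k ≤ w.count u) :
    occurrencePosition w u k ≤ w.length := by
  rw [occurrencePosition_le_iff hk, List.take_length]
  exact hk

lemma pairPrecedes_iff_occurrencePosition_lt {w : List V} {u v : V} {i : ℕ}
    (hu : 2 * i + 2 ≤ w.count u) (hv : 2 * i + 2 ≤ w.count v) :
    PairPrecedes w i u v ↔
      occurrencePosition w u (2 * i + 2) < occurrencePosition w v (2 * i + 1) := by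
  have hv' : 2 * i + 1 ≤ w.count v := by omega
  constructor
  · rintro ⟨p, hp, h1, h2⟩
    rw [List.prefix_iff_eq_take.1 hp] at h1 h2
    refine lt_of_le_of_lt ((occurrencePosition_le_iff hu _).2 h1) (lt_of_not_ge fun h => ?_)
    rw [occurrencePosition_le_iff hv'] at h
    omega
  · intro h
    rw [← not_le, occurrencePosition_le_iff hv'] at h
    exact ⟨_, List.take_prefix _ _, (occurrencePosition_le_iff hu _).1 le_rfl, by omega⟩

/-- For every word there are intervals on `d` lines that reproduce the mutual position of the pairs
of occurrences of the letters occurring `2d` times, and isolate all other letters. -/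
lemma exists_intervals_of_word [Finite V] (d : ℕ) (w : List V) :
    ∃ I : V → Fin d → NonemptyInterval ℝ, ∀ u v, u ≠ v →
      (OverlapOrCross d (LeftOnLine I) u v ↔
        (w.count u = 2 * d ∧ w.count v = 2 * d) ∧ OverlapOrCross d (PairPrecedes w) u v) := by
  obtain ⟨f, hf⟩ := exists_injective_nat V
  have hmono : ∀ (v : V) (i : ℕ), i < d → w.count v = 2 * d →
      occurrencePosition w v (2 * i + 1) ≤ occurrencePosition w v (2 * i + 2) := by
    intro v i hi hv
    rw [occurrencePosition_le_iff (by omega)]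
    have := (occurrencePosition_le_iff (w := w) (u := v) (k := 2 * i + 2) (by omega) _).1 le_rfl
    omega
  -- Letters with a wrong count must become isolated vertices. They are placed at distinct points,
  -- kept apart by the injective `f` and beyond all positions in `w`.
  let I : V → Fin d → NonemptyInterval ℝ := fun v i =>
    if hv : w.count v = 2 * d then
      ⟨(occurrencePosition w v (2 * i + 1), occurrencePosition w v (2 * i + 2)),
        Nat.cast_le.2 (hmono v i i.2 hv)⟩
    else NonemptyInterval.pure ((w.length + 1 + f v : ℕ) : ℝ)
  have hgood : ∀ v i, w.count v = 2 * d →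
      (I v i).fst = occurrencePosition w v (2 * i + 1) ∧
        (I v i).snd = occurrencePosition w v (2 * i + 2) := by
    intro v i hv
    simp only [I, dif_pos hv, and_self]
  have hbad : ∀ v i, w.count v ≠ 2 * d →
      (I v i).fst = (w.length + 1 + f v : ℕ) ∧ (I v i).snd = (w.length + 1 + f v : ℕ) := by
    intro v i hv
    simp only [I, dif_neg hv]
    exact ⟨rfl, rfl⟩
  have hleft : ∀ u v, w.count v ≠ 2 * d → (w.count u = 2 * d ∨ f u < f v) →
      ¬ OverlapOrCross d (LeftOnLine I) u v := by
    intro u v hv hu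
    refine not_overlapOrCross_of_forall_left fun i hi => ⟨hi, ?_⟩
    rw [(hbad v _ hv).1]
    by_cases hu' : w.count u = 2 * d
    · rw [(hgood u _ hu').2, Nat.cast_lt]
      have := occurrencePosition_le_length (w := w) (u := u) (k := 2 * i + 2) (by omega)
      simp only
      omega
    · rw [(hbad u _ hu').2, Nat.cast_lt]
      have := hu.resolve_left hu'
      omega
  refine ⟨I, fun u v huv => ?_⟩
  by_cases hu : w.count u = 2 * d
  · by_cases hv : w.count v = 2 * d
    · simp only [hu, hv, and_self, true_and]
      have key : ∀ x y, w.count x = 2 * d → w.count y = 2 * d → ∀ i < d,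
          (LeftOnLine I i x y ↔ PairPrecedes w i x y) := by
        intro x y hx hy i hi
        rw [pairPrecedes_iff_occurrencePosition_lt (by omega) (by omega)]
        lift i to Fin d using hi
        rw [leftOnLine_coe_iff, (hgood x i hx).2, (hgood y i hy).1, Nat.cast_lt]
      exact OverlapOrCross.congr fun i hi => ⟨key u v hu hv i hi, key v u hv hu i hi⟩
    · simp only [hv, and_false, false_and, iff_false]
      exact hleft u v hv (Or.inl hu)
  · simp only [hu, false_and, iff_false]
    rcases lt_trichotomy (f u) (f v) with h | h | h
    · by_cases hv : w.count v = 2 * d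
      · rw [overlapOrCross_comm]
        exact hleft v u hu (Or.inl hv)
      · exact hleft u v hv (Or.inr h)
    · exact absurd (hf h) huv
    · rw [overlapOrCross_comm]
      exact hleft v u hu (Or.inr h)

end Position

/-! ### Words from intervals -/

lemma exists_prefix_mem_iff_le {α β : Type*} [LinearOrder β] (key : α → β) (K : β) (l : List α)
    (hl : l.Pairwise fun a b => key a ≤ key b) :
    ∃ p, p <+: l ∧ ∀ x, x ∈ p ↔ x ∈ l ∧ key x ≤ K := by
  induction l with
  | nil => exact ⟨[], List.prefix_rfl, by simp⟩
  | cons a l ih =>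
    rw [List.pairwise_cons] at hl
    by_cases ha : key a ≤ K
    · obtain ⟨p, hp, h⟩ := ih hl.2
      refine ⟨a :: p, (List.prefix_cons_inj a).2 hp, fun x => ?_⟩
      rw [List.mem_cons, List.mem_cons, h]
      constructor
      · rintro (rfl | hx)
        · exact ⟨Or.inl rfl, ha⟩
        · exact ⟨Or.inr hx.1, hx.2⟩
      · rintro ⟨rfl | hx, hK⟩
        · exact Or.inl rfl
        · exact Or.inr ⟨hx, hK⟩
    · refine ⟨[], List.nil_prefix, fun x => ?_⟩
      simp only [List.not_mem_nil, List.mem_cons, false_iff, not_and]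
      rintro (rfl | hx) hK
      · exact ha hK
      · exact ha ((hl.1 x hx).trans hK)

lemma mem_prefix_of_lt {α β : Type*} [LinearOrder β] {key : α → β} {l p : List α}
    (hl : l.Pairwise fun a b => key a ≤ key b) (hp : p <+: l) {x y : α} (hx : x ∈ p) (hy : y ∈ l)
    (hxy : key y < key x) : y ∈ p := by
  obtain ⟨s, rfl⟩ := hp
  rw [List.pairwise_append] at hl
  rcases List.mem_append.1 hy with h | h
  · exact h
  · exact absurd (hl.2.2 x hx y h) (not_le.2 hxy)

/-- Labelled ends are distinct even when their letters agree, so occurrences of a letter in a prefix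
can be counted as a finite set of labels. -/
lemma count_map_fst_eq_card {V X : Type*} [DecidableEq V] [Fintype X]
    {l : List (V × X)} (hl : l.Nodup) (u : V) [DecidablePred fun x => (u, x) ∈ l] :
    (l.map Prod.fst).count u = (Finset.univ.filter fun x : X => (u, x) ∈ l).card := by
  classical
  rw [List.count_eq_countP, List.countP_map, List.countP_eq_length_filter,
    ← List.toFinset_card_of_nodup (hl.filter _)]
  symm
  refine Finset.card_bij (fun x _ => (u, x)) ?_ ?_ ?_
  · simp
  · simp
  · rintro ⟨a, x⟩ h
    simp only [List.mem_toFinset, List.mem_filter, Function.comp_apply, beq_iff_eq] at h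
    obtain ⟨h, rfl⟩ := h
    exact ⟨x, by simpa using h, rfl⟩

section Endpoints

variable {V : Type*} {d : ℕ} (I : V → Fin d → NonemptyInterval ℝ)

/-- The lexicographic key of an end of an interval: the line, the coordinate, the side. -/
noncomputable def endpointKey (x : V × Fin d × Bool) : Fin d ×ₗ ℝ ×ₗ Bool :=
  toLex (x.2.1, toLex (if x.2.2 then (I x.1 x.2.1).snd else (I x.1 x.2.1).fst, x.2.2))

variable {I}

lemma endpointKey_lt_of_line_lt {u v : V} {i j : Fin d} (h : i < j) (b c : Bool) :
    endpointKey I (u, i, b) < endpointKey I (v, j, c) :=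
  (Prod.Lex.toLex_lt_toLex).2 (Or.inl h)

/-- At equal coordinates `false < true` puts left ends first, as it must be since touching closed
intervals intersect. -/
lemma endpointKey_left_lt_right {u v : V} {i : Fin d} (h : (I u i).fst ≤ (I v i).snd) :
    endpointKey I (u, i, false) < endpointKey I (v, i, true) := by
  refine (Prod.Lex.toLex_lt_toLex).2 (Or.inr ⟨rfl, (Prod.Lex.toLex_lt_toLex).2 ?_⟩)
  rcases h.lt_or_eq with h | h
  · exact Or.inl (by simpa using h)
  · exact Or.inr ⟨by simpa using h, by simp⟩

lemma endpointKey_lt_of_lt {u v : V} {i : Fin d} (h : (I u i).snd < (I v i).fst) (b : Bool) :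
    endpointKey I (u, i, true) < endpointKey I (v, i, b) := by
  refine (Prod.Lex.toLex_lt_toLex).2 (Or.inr ⟨rfl, (Prod.Lex.toLex_lt_toLex).2 (Or.inl ?_)⟩)
  have := (I v i).fst_le_snd
  cases b <;> simp <;> linarith

variable (I) in
/-- Intervals on `d` lines are encoded by a word in which every letter occurs `2d` times. -/
lemma exists_word_of_intervals [Fintype V] [DecidableEq V] :
    ∃ w : List V, (∀ v, w.count v = 2 * d) ∧ w.length = Fintype.card V * (d * 2) ∧
      ∀ i < d, ∀ u v, PairPrecedes w i u v ↔ LeftOnLine I i u v := by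
  classical
  let r : V × Fin d × Bool → V × Fin d × Bool → Prop := fun x y =>
    endpointKey I x ≤ endpointKey I y
  have : IsTrans _ r := ⟨fun _ _ _ => le_trans⟩
  have : Std.Total r := ⟨fun _ _ => le_total _ _⟩
  let l := (Finset.univ : Finset (V × Fin d × Bool)).toList.insertionSort r
  have hsort : l.Pairwise fun x y => endpointKey I x ≤ endpointKey I y :=
    List.pairwise_insertionSort r _
  have hperm := List.perm_insertionSort r (Finset.univ : Finset (V × Fin d × Bool)).toList
  have hnd : l.Nodup := hperm.nodup_iff.2 (Finset.nodup_toList _)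
  have hmem : ∀ x, x ∈ l := fun x => hperm.mem_iff.2 (by simp)
  refine ⟨l.map Prod.fst, fun v => ?_, ?_, ?_⟩
  · rw [count_map_fst_eq_card hnd]
    simp [hmem, mul_comm]
  · rw [List.length_map, hperm.length_eq, Finset.length_toList]
    simp
  intro i hi u v
  lift i to Fin d using hi
  have hIio : (Finset.Iio i ×ˢ (Finset.univ : Finset Bool)).card = 2 * i := by
    simp [mul_comm]
  have hIic : (Finset.Iic i ×ˢ (Finset.univ : Finset Bool)).card = 2 * i + 2 := by
    simp; ring
  rw [leftOnLine_coe_iff]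
  constructor
  · rintro ⟨q, hq, h1, h2⟩
    obtain ⟨p, hp, rfl⟩ := List.prefix_map_iff.1 hq
    by_contra hne
    have hpn := hnd.sublist hp.sublist
    rw [count_map_fst_eq_card hpn] at h1 h2
    -- Only `2i + 1` ends of `u` come strictly before its right end on line `i`, so `2i + 2`
    -- occurrences reach at least that far.
    have hx : ∃ x : Fin d × Bool, (u, x) ∈ p ∧
        endpointKey I (u, i, true) ≤ endpointKey I (u, x) := by
      by_contra! hx
      have hsub : (Finset.univ.filter fun x : Fin d × Bool => (u, x) ∈ p) ⊆
          (Finset.Iic i ×ˢ (Finset.univ : Finset Bool)).erase (i, true) := by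
        rintro ⟨j, b⟩ hj
        have hlt := hx (j, b) (by simpa using hj)
        rw [Finset.mem_erase, Finset.mem_product, Finset.mem_Iic]
        refine ⟨?_, ?_, Finset.mem_univ _⟩
        · rintro h
          rw [h] at hlt
          exact lt_irrefl _ hlt
        · by_contra h
          exact lt_asymm hlt (endpointKey_lt_of_line_lt (not_le.1 h) _ _)
      have := Finset.card_le_card hsub
      rw [Finset.card_erase_of_mem (by simp), hIic] at this
      omega
    obtain ⟨x, hxp, hx⟩ := hx
    -- If `u` is not left of `v`, the prefix also contains the left end of `v` on line `i` and its
    -- `2i` ends on earlier lines, one too many.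
    have hsub : insert (i, false) (Finset.Iio i ×ˢ (Finset.univ : Finset Bool)) ⊆
        Finset.univ.filter fun x : Fin d × Bool => (v, x) ∈ p := by
      rintro ⟨j, b⟩ hj
      rw [Finset.mem_filter]
      refine ⟨Finset.mem_univ _, mem_prefix_of_lt hsort hp hxp (hmem _) (lt_of_lt_of_le ?_ hx)⟩
      rcases Finset.mem_insert.1 hj with h | h
      · rw [h]
        exact endpointKey_left_lt_right (not_lt.1 hne)
      · exact endpointKey_lt_of_line_lt (Finset.mem_Iio.1 (Finset.mem_product.1 h).1) _ _
    have := Finset.card_le_card hsub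
    rw [Finset.card_insert_of_notMem (by simp), hIio] at this
    omega
  · intro h
    -- The witness is the prefix cut right after the right end of `u` on line `i`.
    obtain ⟨p, hp, hpm⟩ := exists_prefix_mem_iff_le (endpointKey I) (endpointKey I (u, i, true)) l
      hsort
    have hpn := hnd.sublist hp.sublist
    refine ⟨p.map Prod.fst, hp.map _, ?_, ?_⟩
    · rw [count_map_fst_eq_card hpn, ← hIic]
      refine Finset.card_le_card ?_
      rintro ⟨j, b⟩ hj
      have hj := Finset.mem_Iic.1 (Finset.mem_product.1 hj).1
      rw [Finset.mem_filter, hpm]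
      refine ⟨Finset.mem_univ _, hmem _, ?_⟩
      rcases hj.lt_or_eq with hj | rfl
      · exact (endpointKey_lt_of_line_lt hj _ _).le
      · cases b
        · exact (endpointKey_left_lt_right (I u j).fst_le_snd).le
        · exact le_rfl
    · rw [count_map_fst_eq_card hpn, ← hIio]
      refine Finset.card_le_card ?_
      rintro ⟨j, b⟩ hj
      rw [Finset.mem_filter, hpm] at hj
      rw [Finset.mem_product, Finset.mem_Iio]
      refine ⟨lt_of_not_ge fun hij => not_lt.2 hj.2.2 ?_, Finset.mem_univ _⟩
      rcases hij.lt_or_eq with hij | rfl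
      · exact endpointKey_lt_of_line_lt hij _ _
      · exact endpointKey_lt_of_lt h b

end Endpoints

/-! ### Represented graphs are `d`-trapezoid graphs -/

/-- The length is recorded for counting words later; `hd` ensures that every vertex occurs. -/
lemma isRepresentedBy_of_isIntersectionGraph {V : Type*} [Fintype V] {d : ℕ} (hd : 1 ≤ d)
    {G : SimpleGraph V} {I : V → Fin d → NonemptyInterval ℝ}
    (hG : IsIntersectionGraph G fun v => dTrapezoid (I v)) :
    ∃ w : List V, w.length = Fintype.card V * (d * 2) ∧ IsRepresentedBy (trapLanguage d) G w := by
  classical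
  obtain ⟨w, hcount, hlen, hw⟩ := exists_word_of_intervals I
  refine ⟨w, hlen, fun v => ?_, fun u v huv => ?_⟩
  · rw [← List.count_pos_iff, hcount]
    omega
  · rw [hG u v, pairProjection_mem_trapLanguage_iff huv, dTrapezoid_inter_nonempty_iff,
      hcount, hcount]
    simp only [huv, ne_eq, not_false_eq_true, true_and, and_self]
    exact OverlapOrCross.congr fun i hi => ⟨(hw i hi u v).symm, (hw i hi v u).symm⟩

theorem representedGraphs_trapLanguage {d : ℕ} (hd : 1 ≤ d) :
    representedGraphs.{u} (trapLanguage d) = dTrapezoidGraphs.{u} d := by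
  classical
  funext V G
  refine propext ⟨?_, ?_⟩
  · rintro ⟨w, hmem, hw⟩
    have : Finite V := Set.finite_univ_iff.1
      ((List.finite_toSet w).subset fun v _ => hmem v)
    obtain ⟨I, hI⟩ := exists_intervals_of_word d w
    refine ⟨inferInstance, I, fun u v => ?_⟩
    by_cases huv : u = v
    · simp [huv]
    · rw [hw u v huv, pairProjection_mem_trapLanguage_iff huv, dTrapezoid_inter_nonempty_iff,
        hI u v huv]
      simp only [huv, ne_eq, not_false_eq_true, true_and]
  · rintro ⟨hfin, I, hI⟩
    have := Fintype.ofFinite V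
    obtain ⟨w, -, hw⟩ := isRepresentedBy_of_isIntersectionGraph hd hI
    exact ⟨w, hw⟩

/-! ### Speed -/

lemma speed_dTrapezoidGraphs_le {d : ℕ} (hd : 1 ≤ d) (n : ℕ) :
    speed (dTrapezoidGraphs d) n ≤ n ^ (n * (d * 2)) := by
  have hex : ∀ G ∈ {G : SimpleGraph (Fin n) | dTrapezoidGraphs d (Fin n) G},
      ∃ w : List (Fin n), w.length = n * (d * 2) ∧ IsRepresentedBy (trapLanguage d) G w := by
    rintro G ⟨-, I, hI⟩
    simpa using isRepresentedBy_of_isIntersectionGraph hd hI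
  choose! f hflen hfrep using hex
  have hcard : {w : List (Fin n) | w.length = n * (d * 2)}.ncard = n ^ (n * (d * 2)) := by
    have h : Fintype.card (List.Vector (Fin n) (n * (d * 2))) = n ^ (n * (d * 2)) := by
      rw [card_vector, Fintype.card_fin]
    rw [← h, ← Nat.card_eq_fintype_card]
    rfl
  rw [← hcard]
  refine Set.ncard_le_ncard_of_injOn f hflen ?_ (List.finite_length_eq _ _)
  intro G hG H hH hGH
  ext u v
  by_cases huv : u = v
  · simp [huv]
  · rw [(hfrep G hG).2 u v huv, (hfrep H hH).2 u v huv, hGH]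

/-- The vertices of `Fin n` below `m` lie at different points, numbered from 0; every other vertex
`j` lies at the point `f (j - m)`. -/
def clusterPoint {m n : ℕ} (f : Fin (n - m) → Fin (m + 1)) (x : Fin n) : ℕ :=
  if h : m ≤ x then f ⟨x - m, by omega⟩ else x

/-- The disjoint union of cliques in which vertices at the same point are adjacent. -/
def clusterGraph {m n : ℕ} (f : Fin (n - m) → Fin (m + 1)) : SimpleGraph (Fin n) where
  Adj x y := x ≠ y ∧ clusterPoint f x = clusterPoint f y
  symm := ⟨fun _ _ h => ⟨h.1.symm, h.2.symm⟩⟩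
  loopless := ⟨fun _ h => h.1 rfl⟩

/-- The neighbour of vertex `m + j` among the first `m` vertices reveals `f j`. Having no such
neighbour means the spare value `m`. -/
lemma clusterGraph_injective {m n : ℕ} (hmn : m ≤ n) :
    Function.Injective (clusterGraph (m := m) (n := n)) := by
  have hadj : ∀ (f : Fin (n - m) → Fin (m + 1)) (j : Fin (n - m)) (i : ℕ) (hi : i < m),
      (clusterGraph f).Adj ⟨m + j, by omega⟩ ⟨i, by omega⟩ ↔ (f j : ℕ) = i := by
    intro f j i hi
    have h1 : clusterPoint f ⟨m + j, by omega⟩ = f j := by simp [clusterPoint]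
    have h2 : clusterPoint f ⟨i, by omega⟩ = i := by simp [clusterPoint, hi]
    have h3 : m + (j : ℕ) ≠ i := by omega
    simp [clusterGraph, h1, h2, h3]
  intro f g hfg
  funext j
  by_contra hne
  have hne' : (f j : ℕ) ≠ g j := fun h => hne (Fin.ext h)
  by_cases hf : (f j : ℕ) < m
  · have := (hadj f j _ hf).2 rfl
    rw [hfg, hadj g j _ hf] at this
    exact hne' this.symm
  · by_cases hg : (g j : ℕ) < m
    · have := (hadj g j _ hg).2 rfl
      rw [← hfg, hadj f j _ hg] at this
      exact hne' this
    · omega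

/-- Each vertex gets the same one-point interval on all lines. The order never changes between
lines, so only equal points intersect. -/
lemma dTrapezoidGraphs_clusterGraph {d m n : ℕ} (hd : 1 ≤ d) (f : Fin (n - m) → Fin (m + 1)) :
    dTrapezoidGraphs d (Fin n) (clusterGraph f) := by
  let I : Fin n → Fin d → NonemptyInterval ℝ := fun x _ =>
    NonemptyInterval.pure (clusterPoint f x : ℝ)
  refine ⟨inferInstance, I, fun u v => and_congr_right fun _ =>
    (?_ : _ ↔ OverlapOrCross d (LeftOnLine I) u v).trans dTrapezoid_inter_nonempty_iff.symm⟩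
  have hL : ∀ i < d, ∀ x y,
      (LeftOnLine I i x y ↔ clusterPoint f x < clusterPoint f y) := by
    intro i hi x y
    lift i to Fin d using hi
    rw [leftOnLine_coe_iff]
    exact Nat.cast_lt
  rw [OverlapOrCross.congr (S := fun _ x y => clusterPoint f x < clusterPoint f y)
    fun i hi => ⟨hL i hi u v, hL i hi v u⟩]
  constructor
  · exact fun h => Or.inl ⟨0, hd, by omega, by omega⟩
  · rintro (⟨i, _, h⟩ | ⟨i, _, h⟩) <;> omega

lemma le_speed_dTrapezoidGraphs {d m n : ℕ} (hd : 1 ≤ d) (hmn : m ≤ n) :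
    (m + 1) ^ (n - m) ≤ speed (dTrapezoidGraphs d) n := by
  have h : (Set.range (clusterGraph (m := m) (n := n))).ncard = (m + 1) ^ (n - m) := by
    rw [← Set.image_univ, Set.ncard_image_of_injective _ (clusterGraph_injective hmn),
      Set.ncard_univ]
    simp
  rw [← h]
  refine Set.ncard_le_ncard ?_ (Set.toFinite _)
  rintro _ ⟨f, rfl⟩
  exact dTrapezoidGraphs_clusterGraph hd f

theorem isFactorialClass_dTrapezoidGraphs {d : ℕ} (hd : 1 ≤ d) :
    IsFactorialClass (dTrapezoidGraphs d) := by
  -- With `m = n / 2` the lower bound `(m + 1) ^ (n - m)` has base at least `√n` and exponent at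
  -- least half of `n`, hence the constant 1/4.
  refine ⟨1 / 4, d * 2, by norm_num, by positivity, fun n hn => ⟨?_, ?_⟩⟩
  · have hn' : (1 : ℝ) ≤ n := by exact_mod_cast hn
    refine le_trans ?_ (Nat.cast_le.2 (le_speed_dTrapezoidGraphs hd (Nat.div_le_self n 2)))
    have hbase : (n : ℝ) ^ (1 / 2 : ℝ) ≤ ((n / 2 : ℕ) : ℝ) + 1 := by
      rw [← Real.sqrt_eq_rpow]
      refine Real.sqrt_le_iff.2 ⟨by positivity, ?_⟩
      have : n ≤ (n / 2 + 1) ^ 2 := by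
        have : n ≤ 2 * (n / 2) + 1 := by omega
        nlinarith
      exact_mod_cast this
    have hexp : (n : ℝ) / 2 ≤ ((n - n / 2 : ℕ) : ℝ) := by
      have : n ≤ 2 * (n - n / 2) := by omega
      have : (n : ℝ) ≤ 2 * ((n - n / 2 : ℕ) : ℝ) := by exact_mod_cast this
      linarith
    calc (n : ℝ) ^ (1 / 4 * (n : ℝ)) = ((n : ℝ) ^ (1 / 2 : ℝ)) ^ ((n : ℝ) / 2) := by
          rw [← Real.rpow_mul (by positivity)]
          ring_nf
      _ ≤ (((n / 2 : ℕ) : ℝ) + 1) ^ ((n : ℝ) / 2) :=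
          Real.rpow_le_rpow (by positivity) hbase (by positivity)
      _ ≤ (((n / 2 : ℕ) : ℝ) + 1) ^ ((n - n / 2 : ℕ) : ℝ) :=
          Real.rpow_le_rpow_of_exponent_le (by simp) hexp
      _ = (((n / 2 + 1) ^ (n - n / 2) : ℕ) : ℝ) := by
          rw [Real.rpow_natCast]
          push_cast
          rfl
  · refine (Nat.cast_le.2 (speed_dTrapezoidGraphs_le hd n)).trans_eq ?_
    rw [Nat.cast_pow, ← Real.rpow_natCast]
    push_cast
    rw [mul_comm]

theorem mainTheorem5 :
    (∀ d : ℕ, 1 ≤ d →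
      -- the language is finite, `2d`-uniform and symmetric
      (trapLanguage d : Set (List (Fin 2))).Finite ∧
      (∀ w ∈ trapLanguage d, IsUniformWord (2 * d) w) ∧
      IsSymmLanguage (trapLanguage d) ∧
      -- it represents exactly the `d`-trapezoid graphs
      representedGraphs.{u} (trapLanguage d) = dTrapezoidGraphs.{u} d ∧
      -- which therefore have factorial speed
      IsFactorialClass (dTrapezoidGraphs d)) ∧
    IsFactorialClass trapezoidGraphs := by
  refine ⟨fun d hd => ⟨finite_trapLanguage d, fun w hw => hw.1, isSymmLanguage_trapLanguage d,
    representedGraphs_trapLanguage hd, isFactorialClass_dTrapezoidGraphs hd⟩, ?_⟩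
  rw [trapezoidGraphs_eq]
  exact isFactorialClass_dTrapezoidGraphs one_le_two
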